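/- For a pointed topological space $(X,x_0)$ and $m\ge 1$ let $\tau_m(X)=\tau_m(X,x_0)=\pi_1\bigl(X^{T^{m-1}},\overline{x_0}\bigr)$ be the $m$-th Fox torus homotopy group, where $X^{T^{m-1}}$ is the space of all (unbased) continuous maps from the $(m-1)$-torus $T^{m-1}=(S^1)^{m-1}$ to $X$ with the compact-open topology, and $\overline{x_0}$ is the constant map at $x_0$. For $n\ge1$ and a group $\pi$, a space of type $K(\pi,n)$ is a path-connected topological space $X$ with $\pi_n(X)\cong\pi$ and $\pi_k(X)=1$ for all $k\geq 1$, $k\ne n$. (1) Let $n\ge 2$, let $\pi$ be an abelian group, and let $X$ be a space of type $K(\pi,n)$ with any base point. Then $\tau_m(X)\cong\pi_m(X)$ for $1\le m\le n$; for every $k\ge 0$, $$\tau_{n+k}(X)\cong\bigoplus_{j=0}^{k}\pi_n(X)^{\binom{n-2+j}{n-2}},\qquad \sum_{j=0}^{k}\binom{n-2+j}{n-2}=\binom{n+k-1}{k};$$ and therefore, for $m\ge 1$, $$\tau_m(X)\cong\begin{cases}1,&\text{if } m<n,\\ \pi^{\binom{m-1}{m-n}},&\text{if } m\ge n.\end{cases}$$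 (2) Let $\pi$ be any group and let $X$ be a space of type $K(\pi,1)$ with any base point. Then $\tau_k(X)\cong\pi$ for all $k\ge 1$. -/

import Mathlib

open scoped Topology

universe u v

/-- The Fox torus homotopy group `τ_m(X, x₀) = π₁(X^{T^{m-1}}, const x₀)`, for `m ≥ 1`.
Here `X^{T^{m-1}}` is the space of all (unbased) continuous maps from the `(m-1)`-torus
`(ℝ/ℤ)^{m-1}` to `X` with the compact-open topology, and the base point is the constant map
at `x₀`. -/
abbrev FoxTorusGroup (m : ℕ) (X : Type u) [TopologicalSpace X] (x₀ : X) : Type u :=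
  FundamentalGroup C(UnitAddTorus (Fin (m - 1)), X) (ContinuousMap.const _ x₀)

/-- `X` is an Eilenberg–MacLane space of type `(G, n)`, `n ≥ 1`: it is path connected, its `n`-th
homotopy group is isomorphic to `G`, and all its other homotopy groups are trivial. -/
structure IsEilenbergMacLane (G : Type v) [Group G] (n : ℕ) [NeZero n]
    (X : Type u) [TopologicalSpace X] : Prop where
  pathConnected : PathConnectedSpace X
  nonempty_mulEquiv : ∀ x : X, Nonempty (π_ n X x ≃* G)
  subsingleton_of_ne : ∀ (k : ℕ) [NeZero k], k ≠ n → ∀ x : X, Subsingleton (π_ k X x)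

/-! Evaluation at the base point, from the free loop space `L A` to `A`, has fibre `Ω A` and is
split by the constant loops. It therefore induces a split short exact sequence on fundamental
groups. Exactness is proved by hand, by conjugating loops with the track of their base points
(`exists_incl_eq`, `incl_injective`). Since `Ω` and `L` commute, the groups `G(a, m) = π₁(Ω^a L^m
A)` fit into split extensions `1 → G(a+1, m) → G(a, m+1) → G(a, m) → 1`.

By the exponential law, `τ_m = G(0, m-1)` and `π_n = G(n-1, 0)`. For a `K(π, n)` only `G(r, 0)` with
`r = n-1` can be nontrivial. If the extensions are direct products, the recursion is Pascal's rule,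
so `G(r-k, m) ≅ π^(m.choose k)`, and `k = r` gives the theorem (`nonempty_mulEquiv_choose`).

A split extension of abelian groups is only a semidirect product, so commutativity of the middle
group needs its own argument (`loopFreeGroup_commute`): where it is not immediate, an element is
determined by its restrictions to coordinate subtori, and those of a commutator vanish by induction.
For `n = 1` all kernels vanish and `π` may be nonabelian. -/

open scoped unitInterval
open CategoryTheory

/-! ### Pointed spaces and the fundamental group functor -/

/-- A topological space with a base point. -/
structure PointedTop : Type (u + 1) where
  /-- The underlying type. -/
  carrier : Type u
  [top : TopologicalSpace carrier]
  /-- The base point. -/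
  pt : carrier

namespace PointedTop

instance : CoeSort PointedTop.{u} (Type u) := ⟨carrier⟩

attribute [instance] top

/-- A continuous map that preserves base points. -/
@[ext]
structure Hom (A B : PointedTop.{u}) where
  /-- The underlying continuous map. -/
  toMap : C(A, B)
  map_pt : toMap A.pt = B.pt

@[simps]
instance : Category PointedTop.{u} where
  Hom := Hom
  id A := ⟨.id A, rfl⟩
  comp f g := ⟨g.toMap.comp f.toMap, by simp [f.map_pt, g.map_pt]⟩

variable {A B C : PointedTop.{u}}

@[ext]
theorem hom_ext {f g : A ⟶ B} (h : ∀ a, f.toMap a = g.toMap a) : f = g :=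
  Hom.ext (ContinuousMap.ext h)

/-- A homeomorphism that preserves base points, as an isomorphism. -/
@[simps]
def isoOfHomeomorph (e : A ≃ₜ B) (he : e A.pt = B.pt) : A ≅ B where
  hom := ⟨e, he⟩
  inv := ⟨e.symm, by rw [← he]; exact e.symm_apply_apply _⟩
  hom_inv_id := by ext a; exact e.symm_apply_apply a
  inv_hom_id := by ext a; exact e.apply_symm_apply a

theorem mapOfEq_mk (f : C(A, B)) (h : f A.pt = B.pt) (p : Path A.pt A.pt) :
    FundamentalGroup.mapOfEq f h (Path.Homotopic.Quotient.mk p) =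
      Path.Homotopic.Quotient.mk ((p.map f.continuous).cast h.symm h.symm) :=
  FundamentalGroup.mapOfEq_apply f h (Path.Homotopic.Quotient.mk p)

/-- The fundamental group as a functor. -/
noncomputable def pi1 : PointedTop.{u} ⥤ GrpCat.{u} where
  obj A := GrpCat.of (FundamentalGroup A A.pt)
  map f := GrpCat.ofHom (FundamentalGroup.mapOfEq f.toMap f.map_pt)
  map_id A := by
    ext x
    induction x using Path.Homotopic.Quotient.ind with | _ p
    exact mapOfEq_mk _ (Hom.map_pt (𝟙 A : A ⟶ A)) p
  map_comp f g := by
    ext x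
    induction x using Path.Homotopic.Quotient.ind with | _ p
    refine (mapOfEq_mk _ (Hom.map_pt (f ≫ g)) p).trans ?_
    exact ((congrArg (FundamentalGroup.mapOfEq g.toMap g.map_pt) (mapOfEq_mk _ f.map_pt p)).trans
      (mapOfEq_mk _ g.map_pt _)).symm

/-- The class of a loop in the fundamental group. -/
def loopClass (p : Path A.pt A.pt) : pi1.obj A := Path.Homotopic.Quotient.mk p

theorem loopClass_surjective (x : pi1.obj A) : ∃ p, loopClass p = x :=
  Path.Homotopic.Quotient.mk_surjective x

theorem loopClass_eq_iff {p q : Path A.pt A.pt} : loopClass p = loopClass q ↔ p.Homotopic q :=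
  Path.Homotopic.Quotient.eq

theorem one_eq_loopClass : (1 : pi1.obj A) = loopClass (.refl _) := rfl

theorem map_loopClass (f : A ⟶ B) (p : Path A.pt A.pt) : pi1.map f (loopClass p) =
    loopClass ((p.map f.toMap.continuous).cast f.map_pt.symm f.map_pt.symm) :=
  mapOfEq_mk _ f.map_pt p

/-! ### Based and free loop spaces -/

/-- The space of based loops. -/
abbrev loopObj (A : PointedTop.{u}) : PointedTop.{u} := ⟨Path A.pt A.pt, .refl _⟩

/-- The space of free loops. -/
abbrev freeObj (A : PointedTop.{u}) : PointedTop.{u} :=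
  ⟨{γ : C(I, A) // γ 0 = γ 1}, ⟨.const _ A.pt, rfl⟩⟩

theorem continuous_into_freeObj {Y : Type*} [TopologicalSpace Y] {f : Y → freeObj A}
    (h : Continuous fun x : Y × I => (f x.1).1 x.2) : Continuous f :=
  (ContinuousMap.continuous_of_continuous_uncurry _ h).subtype_mk _

theorem continuous_into_loopObj {Y : Type*} [TopologicalSpace Y] {f : Y → loopObj A}
    (h : Continuous fun x : Y × I => f x.1 x.2) : Continuous f :=
  Path.continuous_uncurry_iff.1 h

/-- The based loop space functor. -/
@[simps]
def loopF : PointedTop.{u} ⥤ PointedTop.{u} where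
  obj := loopObj
  map {A B} f :=
    { toMap := ⟨fun p => (p.map f.toMap.continuous).cast f.map_pt.symm f.map_pt.symm,
        continuous_into_loopObj (by simp only [Path.cast_coe, Path.map_coe]; fun_prop)⟩
      map_pt := by ext; exact f.map_pt }

/-- The free loop space functor. -/
@[simps]
def freeF : PointedTop.{u} ⥤ PointedTop.{u} where
  obj := freeObj
  map {A B} f :=
    { toMap := ⟨fun p => ⟨f.toMap.comp p.1, by simp [p.2]⟩,
        continuous_into_freeObj (by simp only [ContinuousMap.comp_apply]; fun_prop)⟩
      map_pt := by ext; exact f.map_pt }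

/-- Evaluation of free loops at the base point of the circle. -/
def ev (A : PointedTop.{u}) : freeObj A ⟶ A where
  toMap := ⟨fun p => p.1 0, by dsimp; fun_prop⟩
  map_pt := rfl

/-- The constant free loops. -/
def const (A : PointedTop.{u}) : A ⟶ freeObj A where
  toMap := ⟨fun a => ⟨.const _ a, rfl⟩, continuous_into_freeObj (by dsimp; fun_prop)⟩
  map_pt := rfl

/-- The inclusion of the based loops into the free loops. -/
def inclMap (A : PointedTop.{u}) : loopObj A ⟶ freeObj A where
  toMap := ⟨fun p => ⟨p.toContinuousMap, by simp⟩,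
    continuous_into_freeObj (by dsimp; fun_prop)⟩
  map_pt := rfl

/-- The inclusion of the based loops into the free loops as a natural transformation. -/
@[simps]
def incl : loopF.{u} ⟶ freeF where
  app := inclMap

/-- Based loops of free loops are free loops of based loops. -/
def swapIso (A : PointedTop.{u}) : loopObj (freeObj A) ≅ freeObj (loopObj A) where
  hom :=
    { toMap := ⟨fun p => ⟨⟨fun t => ⟨⟨fun s => (p s).1 t, by fun_prop⟩, by simp, by simp⟩,
        continuous_into_loopObj (by dsimp; fun_prop)⟩, by ext s; exact (p s).2⟩,
        continuous_into_freeObj (continuous_into_loopObj (by dsimp; fun_prop))⟩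
      map_pt := rfl }
  inv :=
    { toMap := ⟨fun p => ⟨⟨fun s => ⟨⟨fun t => p.1 t s, by fun_prop⟩, by simp [p.2]⟩,
        continuous_into_freeObj (by dsimp; fun_prop)⟩, by ext; simp, by ext; simp⟩,
        continuous_into_loopObj (continuous_into_freeObj (by dsimp; fun_prop))⟩
      map_pt := rfl }
  hom_inv_id := rfl
  inv_hom_id := rfl

/-- Based loops of free loops are free loops of based loops, naturally. -/
@[simps!]
def swap : freeF.{u} ⋙ loopF ≅ loopF ⋙ freeF :=
  NatIso.ofComponents swapIso fun _ => rfl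

theorem homotopic_of_continuous {X : Type*} [TopologicalSpace X] {x y : X} {p q : Path x y}
    (H : I → I → X) (hc : Continuous fun z : I × I => H z.1 z.2) (h0 : ∀ s, H 0 s = p s)
    (h1 : ∀ s, H 1 s = q s) (hs : ∀ u, H u 0 = x) (ht : ∀ u, H u 1 = y) : p.Homotopic q :=
  ⟨{ toFun := fun z => H z.1 z.2
     continuous_toFun := hc
     map_zero_left := h0
     map_one_left := h1
     prop' := by
      rintro u s (rfl | rfl)
      · exact (hs u).trans p.source.symm
      · exact (ht u).trans p.target.symm }⟩

/-- By the exponential law, a homotopy between loops of loops is a continuous function of three real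
parameters, which can be written down by formulas. -/
theorem homotopic_loopObj_of_continuous {p q : Path (loopObj A).pt (loopObj A).pt}
    (H : I → I → I → A) (hc : Continuous fun z : (I × I) × I => H z.1.1 z.1.2 z.2)
    (h0 : ∀ s t, H 0 s t = p s t) (h1 : ∀ s t, H 1 s t = q s t) (hs : ∀ u t, H u 0 t = A.pt)
    (ht : ∀ u t, H u 1 t = A.pt) (hl : ∀ u s, H u s 0 = A.pt) (hr : ∀ u s, H u s 1 = A.pt) :
    p.Homotopic q :=
  homotopic_of_continuous
    (fun u s => (⟨⟨H u s, hc.comp (Continuous.prodMk_right (u, s))⟩, hl u s, hr u s⟩ :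
      Path A.pt A.pt))
    (continuous_into_loopObj hc)
    (fun s => Path.ext (funext (h0 s))) (fun s => Path.ext (funext (h1 s)))
    (fun u => Path.ext (funext (hs u))) (fun u => Path.ext (funext (ht u)))

theorem homotopic_freeObj_of_continuous {p q : Path (freeObj A).pt (freeObj A).pt}
    (H : I → I → I → A) (hc : Continuous fun z : (I × I) × I => H z.1.1 z.1.2 z.2)
    (h0 : ∀ s t, H 0 s t = (p s).1 t) (h1 : ∀ s t, H 1 s t = (q s).1 t)
    (hs : ∀ u t, H u 0 t = A.pt) (ht : ∀ u t, H u 1 t = A.pt) (hl : ∀ u s, H u s 0 = H u s 1) :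
    p.Homotopic q :=
  homotopic_of_continuous
    (fun u s => (⟨⟨H u s, hc.comp (Continuous.prodMk_right (u, s))⟩, hl u s⟩ : freeObj A))
    (continuous_into_freeObj hc)
    (fun s => Subtype.ext (ContinuousMap.ext (h0 s)))
    (fun s => Subtype.ext (ContinuousMap.ext (h1 s)))
    (fun u => Subtype.ext (ContinuousMap.ext (hs u)))
    (fun u => Subtype.ext (ContinuousMap.ext (ht u)))

/-! ### Exactness for the evaluation of free loops -/

/-- The path `p` backwards, then `l`, then the path `p`, parametrized by `[-1, 2]`. -/
noncomputable def glue {X : Type*} (p l : I → X) (r : ℝ) : X :=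
  if r ≤ 0 then p (Set.projIcc 0 1 zero_le_one (-r))
  else if r ≤ 1 then l (Set.projIcc 0 1 zero_le_one r)
  else p (Set.projIcc 0 1 zero_le_one (r - 1))

theorem continuous_glue {X Y : Type*} [TopologicalSpace X] [TopologicalSpace Y]
    {p l : Y → I → X} {r : Y → ℝ} (hp : Continuous fun z : Y × I => p z.1 z.2)
    (hl : Continuous fun z : Y × I => l z.1 z.2) (hr : Continuous r)
    (h0 : ∀ y, p y 0 = l y 0) (h1 : ∀ y, l y 0 = l y 1) :
    Continuous fun y => glue (p y) (l y) (r y) := by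
  have hP : ∀ f : Y → ℝ, Continuous f → Continuous fun y =>
      Set.projIcc (0 : ℝ) 1 zero_le_one (f y) := fun f hf => continuous_projIcc.comp hf
  unfold glue
  refine Continuous.if_le (hp.comp (continuous_id.prodMk (hP _ hr.neg)))
    (Continuous.if_le (hl.comp (continuous_id.prodMk (hP _ hr)))
      (hp.comp (continuous_id.prodMk (hP _ (hr.sub continuous_const)))) hr continuous_const ?_)
    hr continuous_const ?_
  · intro y hy
    simp [hy, h0, h1]
  · intro y hy
    simp [hy, h0]

theorem glue_of_nonpos {X : Type*} (p l : I → X) (u : I) : glue p l (-u) = p u := by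
  rw [glue, if_pos (by simpa using u.2.1), neg_neg, Set.projIcc_val]

theorem glue_coe {X : Type*} {p l : I → X} (h : p 0 = l 0) (t : I) : glue p l t = l t := by
  unfold glue
  split_ifs with h0 h1
  · obtain rfl : t = 0 := le_antisymm h0 t.2.1
    simpa using h
  · rw [Set.projIcc_val]
  · exact absurd t.2.2 h1

theorem glue_one_add {X : Type*} {p l : I → X} (h : p 0 = l 0) (h' : l 0 = l 1) (u : I) :
    glue p l (1 + u) = p u := by
  rcases eq_or_ne u 0 with rfl | hu
  · simpa [h, h'] using glue_coe h 1
  · have : 0 < (u : ℝ) := lt_of_le_of_ne u.2.1 fun e => hu (Subtype.ext e.symm)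
    rw [glue, if_neg (by linarith), if_neg (by linarith), add_sub_cancel_left, Set.projIcc_val]

theorem glue_const {X : Type*} (x : X) (r : ℝ) : glue (fun _ => x) (fun _ => x) r = x := by
  simp [glue]

theorem glue_apply_zero {X : Type*} (p l : I → X) (u : I) :
    glue p l ((1 + 2 * (u : ℝ)) * (0 : I) - u) = p u := by
  simpa using glue_of_nonpos p l u

theorem glue_apply_one {X : Type*} {p l : I → X} (h : p 0 = l 0) (h' : l 0 = l 1) (u : I) :
    glue p l ((1 + 2 * (u : ℝ)) * (1 : I) - u) = p u := by
  rw [← glue_one_add h h' u, Set.Icc.coe_one]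
  congr 1
  ring

/-- A null-homotopy of the base point track `s ↦ P s 0` supplies, for each `s`, a path from that
base point to `A.pt`. Conjugating the free loop `P s` with it gives a based loop. -/
theorem exists_incl_eq (A : PointedTop.{u}) (x : pi1.obj (freeObj A))
    (hx : pi1.map (ev A) x = 1) : ∃ y, pi1.map (inclMap A) y = x := by
  obtain ⟨P, rfl⟩ := loopClass_surjective x
  rw [map_loopClass, one_eq_loopClass, loopClass_eq_iff] at hx
  obtain ⟨h⟩ := hx
  change Path (freeObj A).pt (freeObj A).pt at P
  -- The argument of `glue` sweeps `[-u, 1 + u]` as `t` runs over `I`, so only the part of the path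
  -- up to time `u` is used: `u = 0` gives `P s`, and `u = 1` the fully conjugated loop.
  let H : I → I → I → A := fun u s t =>
    glue (fun v => h (v, s)) (P s).1 ((1 + 2 * (u : ℝ)) * t - u)
  have e0 (s : I) : h (0, s) = (P s).1 0 := h.apply_zero s
  have e1 (s : I) : h (1, s) = A.pt := h.apply_one s
  have hP (s : I) : (P s).1 0 = (P s).1 1 := (P s).2
  have hc : Continuous fun z : (I × I) × I => H z.1.1 z.1.2 z.2 :=
    continuous_glue (p := fun (z : (I × I) × I) v => h (v, z.1.2))
      (l := fun (z : (I × I) × I) => (P z.1.2).1)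
      (h.continuous.comp (by fun_prop)) (by fun_prop) (by fun_prop)
      (fun z => e0 _) (fun z => hP _)
  have hs0 (u t : I) : H u 0 t = A.pt := by
    have : ((P 0).1 : I → A) = fun _ => A.pt := by rw [P.source]; rfl
    simp only [H, this, Path.Homotopy.source]
    exact glue_const _ _
  have hs1 (u t : I) : H u 1 t = A.pt := by
    have : ((P 1).1 : I → A) = fun _ => A.pt := by rw [P.target]; rfl
    simp only [H, this, Path.Homotopy.target]
    exact glue_const _ _
  have hl (u s : I) : H u s 0 = h (u, s) := glue_apply_zero _ _ u
  have hr (u s : I) : H u s 1 = h (u, s) := glue_apply_one (e0 s) (hP s) u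
  let Q : Path (loopObj A).pt (loopObj A).pt :=
    { toFun := fun s => ⟨⟨H 1 s, hc.comp (Continuous.prodMk_right (1, s))⟩,
        (hl 1 s).trans (e1 s), (hr 1 s).trans (e1 s)⟩
      continuous_toFun := continuous_into_loopObj
        (hc.comp (f := fun z : I × I => ((1, z.1), z.2)) (by fun_prop))
      source' := Path.ext (funext (hs0 1))
      target' := Path.ext (funext (hs1 1)) }
  refine ⟨loopClass Q, ?_⟩
  refine (map_loopClass (inclMap A) Q).trans (loopClass_eq_iff.2 ?_)
  refine Path.Homotopic.symm (homotopic_freeObj_of_continuous H hc (fun s t => ?_) (fun s t => rfl)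
    hs0 hs1 fun u s => (hl u s).trans (hr u s).symm)
  simpa [H] using glue_coe (e0 s) t

/-- A null-homotopy `K` through free loops moves the base point. Conjugating `K w s` with the track
back to time `0` makes it based. At `w = 1` what remains is the track, a constant loop and the track
reversed, which contracts. -/
theorem incl_injective (A : PointedTop.{u}) : Function.Injective (pi1.map (inclMap A)) := by
  rw [injective_iff_map_eq_one]
  intro x hx
  obtain ⟨P, rfl⟩ := loopClass_surjective x
  rw [map_loopClass, one_eq_loopClass, loopClass_eq_iff] at hx
  obtain ⟨h⟩ := hx
  change Path (loopObj A).pt (loopObj A).pt at P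
  refine loopClass_eq_iff.2 ?_
  let K : I → I → freeObj A := fun w s => h (w, s)
  have hK (w s : I) : (K w s).1 0 = (K w s).1 1 := (K w s).2
  have k0 (s t : I) : (K 0 s).1 t = P s t := congrArg (fun γ : freeObj A => γ.1 t) (h.apply_zero s)
  have k1 (s : I) : (K 1 s).1 = .const _ A.pt := congrArg Subtype.val (h.apply_one s)
  have ks0 (w : I) : (K w 0).1 = .const _ A.pt := congrArg Subtype.val (h.source w)
  have ks1 (w : I) : (K w 1).1 = .const _ A.pt := congrArg Subtype.val (h.target w)
  have kc : Continuous fun z : (I × I) × I => (K z.1.1 z.1.2).1 z.2 := by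
    have := h.continuous
    fun_prop
  have kc0 : Continuous fun z : I × I => (K z.1 z.2).1 0 :=
    kc.comp (f := fun z => (z, 0)) (by fun_prop)
  let T : ℝ → I := Set.projIcc 0 1 zero_le_one
  have hT : Continuous T := continuous_projIcc
  have T0 (x : ℝ) (hx : x ≤ 0) : T x = 0 := Set.projIcc_of_le_left _ hx
  have T1 (x : ℝ) (hx : 1 ≤ x) : T x = 1 := Set.projIcc_of_right_le _ hx
  have Tv (x : I) : T x = x := Set.projIcc_val _ x
  -- The track from time `w` back to time `0`. The clamp `T` keeps it at `A.pt` for `v ≥ w`.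
  let D : I → I → I → A := fun w s v => (K (T (w - v)) s).1 0
  let H : I → I → I → A := fun w s t => glue (D w s) (K w s).1 ((1 + 2 * (w : ℝ)) * t - w)
  have D0 (w s : I) : D w s 0 = (K w s).1 0 := by simp [D, Tv]
  have Dw (w s : I) : D w s w = A.pt := by simp [D, T0, k0]
  have hl (u s : I) : H u s 0 = A.pt := (glue_apply_zero _ _ u).trans (Dw u s)
  have hr (u s : I) : H u s 1 = A.pt := (glue_apply_one (D0 u s) (hK u s) u).trans (Dw u s)
  have hc : Continuous fun z : (I × I) × I => H z.1.1 z.1.2 z.2 :=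
    continuous_glue (p := fun (z : (I × I) × I) => D z.1.1 z.1.2)
      (l := fun (z : (I × I) × I) => (K z.1.1 z.1.2).1)
      (kc0.comp (f := fun z : ((I × I) × I) × I => (T ((z.1.1.1 : ℝ) - z.2), z.1.1.2))
        (by fun_prop)) (kc.comp (f := fun z : ((I × I) × I) × I => (z.1.1, z.2))
        (by fun_prop)) (by fun_prop)
      (fun z => D0 _ _) (fun z => hK _ _)
  have hs0 (u t : I) : H u 0 t = A.pt := by
    simp only [H, D, ks0, ContinuousMap.const_apply]
    exact glue_const _ _
  have hs1 (u t : I) : H u 1 t = A.pt := by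
    simp only [H, D, ks1]
    exact glue_const _ _
  let Q : Path (loopObj A).pt (loopObj A).pt :=
    { toFun := fun s => ⟨⟨H 1 s, hc.comp (Continuous.prodMk_right (1, s))⟩, hl 1 s, hr 1 s⟩
      continuous_toFun := continuous_into_loopObj
        (hc.comp (f := fun z : I × I => ((1, z.1), z.2)) (by fun_prop))
      source' := Path.ext (funext (hs0 1))
      target' := Path.ext (funext (hs1 1)) }
  refine Path.Homotopic.trans (p₁ := Q) (homotopic_loopObj_of_continuous H hc (fun s t => ?_)
    (fun s t => rfl) hs0 hs1 hl hr) ?_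
  · simpa [H, k0] using glue_coe (D0 0 s) t
  -- At `w = 1` the loop follows the track to time `min (3t) (3 - 3t)`, clamped to `I`. Capping that
  -- time at `1 - v` retracts the excursion to time `0`.
  · let H' : I → I → I → A := fun v s t =>
      (K (T (min (min (3 * (t : ℝ)) (3 - 3 * (t : ℝ))) (1 - v))) s).1 0
    refine homotopic_loopObj_of_continuous H' (kc0.comp
      (f := fun z : (I × I) × I =>
        (T (min (min (3 * (z.2 : ℝ)) (3 - 3 * (z.2 : ℝ))) (1 - z.1.1)), z.1.2)) (by fun_prop))
      (fun s t => ?_) (fun s t => ?_) (fun u t => ?_) (fun u t => ?_) (fun u s => ?_)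
      (fun u s => ?_)
    · change (K (T (min (min (3 * (t : ℝ)) (3 - 3 * (t : ℝ))) (1 - (0 : I)))) s).1 0 =
        glue (D 1 s) (K 1 s).1 ((1 + 2 * ((1 : I) : ℝ)) * t - (1 : I))
      have ht0 := t.2.1
      have ht1 := t.2.2
      unfold glue
      simp only [Set.Icc.coe_one, Set.Icc.coe_zero]
      split_ifs with h0 h1
      · rw [Set.projIcc_of_mem _ ⟨by linarith, by linarith⟩,
          min_eq_left (b := 3 - 3 * (t : ℝ)) (by linarith),
          min_eq_left (by linarith)]
        simp only [D, Set.Icc.coe_one]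
        ring_nf
      · rw [T1 _ (le_min (le_min (by linarith) (by linarith)) (by linarith)), k1]
        rfl
      · rw [Set.projIcc_of_mem _ ⟨by linarith, by linarith⟩,
          min_eq_right (b := 3 - 3 * (t : ℝ)) (by linarith),
          min_eq_left (by linarith)]
        simp only [D, Set.Icc.coe_one]
        ring_nf
    · change (K (T (min _ (1 - ((1 : I) : ℝ)))) s).1 0 = A.pt
      simp [T0, k0]
    · simp [H', ks0]
    · simp [H', ks1]
    · simp [H', T0, k0]
    · simp [H', T0, k0]

/-! ### Iterated loop spaces and the split extensions -/

/-- The iterates of an endofunctor. -/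
def iter (F : PointedTop.{u} ⥤ PointedTop.{u}) : ℕ → PointedTop.{u} ⥤ PointedTop.{u}
  | 0 => 𝟭 _
  | n + 1 => iter F n ⋙ F

/-- Iterated based loops of free loops are free loops of iterated based loops. -/
def swapIter : ∀ a : ℕ, freeF.{u} ⋙ iter loopF a ≅ iter loopF a ⋙ freeF
  | 0 => freeF.rightUnitor ≪≫ freeF.leftUnitor.symm
  | a + 1 => (Functor.associator _ _ _).symm ≪≫ Functor.isoWhiskerRight (swapIter a) loopF ≪≫
      Functor.associator _ _ _ ≪≫ Functor.isoWhiskerLeft (iter loopF a) swap ≪≫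
      (Functor.associator _ _ _).symm

theorem swapIter_hom_ev (a : ℕ) (A : PointedTop.{u}) :
    (swapIter a).hom.app A ≫ ev ((iter loopF a).obj A) = (iter loopF a).map (ev A) := by
  induction a with
  | zero => rfl
  | succ a ih =>
    have h : loopF.map ((swapIter a).hom.app A ≫ ev ((iter loopF a).obj A)) =
        loopF.map ((iter loopF a).map (ev A)) := congrArg loopF.map ih
    -- Swapping the two loop coordinates and then evaluating the free one is, by definition,
    -- `loopF.map` of the evaluation.
    exact h

theorem pi1_map_comp_apply (f : A ⟶ B) (g : B ⟶ C) (x : pi1.obj A) :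
    pi1.map (f ≫ g) x = pi1.map g (pi1.map f x) := by
  rw [pi1.map_comp, ConcreteCategory.comp_apply]

theorem pi1_map_id_apply (x : pi1.obj A) : pi1.map (𝟙 A) x = x := by
  rw [pi1.map_id, ConcreteCategory.id_apply]

/-- Evaluation of the free loops in `Ω^a L A`, on fundamental groups. -/
noncomputable def evHom (a : ℕ) (A : PointedTop.{u}) :
    pi1.obj ((iter loopF a).obj (freeF.obj A)) →* pi1.obj ((iter loopF a).obj A) :=
  (pi1.map ((iter loopF a).map (ev A))).hom

/-- The inclusion of the constant free loops in `Ω^a L A`, on fundamental groups. -/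
noncomputable def constHom (a : ℕ) (A : PointedTop.{u}) :
    pi1.obj ((iter loopF a).obj A) →* pi1.obj ((iter loopF a).obj (freeF.obj A)) :=
  (pi1.map ((iter loopF a).map (const A))).hom

/-- The inclusion of `Ω^(a+1) A` into `Ω^a L A`, on fundamental groups. -/
noncomputable def inclHom (a : ℕ) (A : PointedTop.{u}) :
    pi1.obj ((iter loopF (a + 1)).obj A) →* pi1.obj ((iter loopF a).obj (freeF.obj A)) :=
  (pi1.map ((swapIter a).inv.app A)).hom.comp (pi1.map (incl.app ((iter loopF a).obj A))).hom

theorem pi1_map_ev_incl (A : PointedTop.{u}) (x : pi1.obj (loopObj A)) :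
    pi1.map (ev A) (pi1.map (inclMap A) x) = 1 := by
  obtain ⟨p, rfl⟩ := loopClass_surjective x
  rw [map_loopClass, map_loopClass]
  refine congrArg loopClass (Path.ext (funext fun t => ?_))
  exact (p t).source

theorem evHom_apply (a : ℕ) (A : PointedTop.{u})
    (x : pi1.obj ((iter loopF a).obj (freeF.obj A))) :
    evHom a A x = pi1.map (ev ((iter loopF a).obj A)) (pi1.map ((swapIter a).hom.app A) x) := by
  rw [evHom, ← swapIter_hom_ev]
  exact pi1_map_comp_apply _ _ x

theorem swapIter_inv_hom_apply (a : ℕ) (A : PointedTop.{u})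
    (x : pi1.obj (freeF.obj ((iter loopF a).obj A))) :
    pi1.map ((swapIter a).hom.app A) (pi1.map ((swapIter a).inv.app A) x) = x :=
  (pi1_map_comp_apply _ _ x).symm.trans
    ((congrArg (fun f => pi1.map f x) ((swapIter a).inv_hom_id_app A)).trans
      (pi1_map_id_apply x))

theorem swapIter_hom_inv_apply (a : ℕ) (A : PointedTop.{u})
    (x : pi1.obj ((iter loopF a).obj (freeF.obj A))) :
    pi1.map ((swapIter a).inv.app A) (pi1.map ((swapIter a).hom.app A) x) = x :=
  (pi1_map_comp_apply _ _ x).symm.trans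
    ((congrArg (fun f => pi1.map f x) ((swapIter a).hom_inv_id_app A)).trans
      (pi1_map_id_apply x))

theorem inclHom_injective (a : ℕ) (A : PointedTop.{u}) : Function.Injective (inclHom a A) :=
  (Function.LeftInverse.injective (swapIter_inv_hom_apply a A)).comp (incl_injective _)

theorem evHom_inclHom (a : ℕ) (A : PointedTop.{u}) (x : pi1.obj ((iter loopF (a + 1)).obj A)) :
    evHom a A (inclHom a A x) = 1 := by
  rw [evHom_apply]
  exact (congrArg (pi1.map (ev _)) (swapIter_inv_hom_apply a A _)).trans (pi1_map_ev_incl _ x)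

theorem exists_inclHom_eq (a : ℕ) (A : PointedTop.{u})
    (x : pi1.obj ((iter loopF a).obj (freeF.obj A))) (hx : evHom a A x = 1) :
    ∃ y, inclHom a A y = x := by
  rw [evHom_apply] at hx
  obtain ⟨y, hy⟩ := exists_incl_eq _ _ hx
  exact ⟨y, (congrArg (pi1.map ((swapIter a).inv.app A)) hy).trans (swapIter_hom_inv_apply a A x)⟩

theorem evHom_constHom (a : ℕ) (A : PointedTop.{u}) (x : pi1.obj ((iter loopF a).obj A)) :
    evHom a A (constHom a A x) = x := by
  have h : (iter loopF a).map (const A) ≫ (iter loopF a).map (ev A) = 𝟙 _ :=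
    ((iter loopF a).map_comp _ _).symm.trans ((iter loopF a).map_id A)
  exact (pi1_map_comp_apply _ _ x).symm.trans
    ((congrArg (fun f => pi1.map f x) h).trans (pi1_map_id_apply x))

/-- Needed to carry restrictions to subtori through the kernel inclusion in `faceHom_map_kernelHom`.
-/
theorem inclHom_naturality (a : ℕ) (f : A ⟶ B) (x : pi1.obj ((iter loopF (a + 1)).obj A)) :
    pi1.map ((iter loopF a).map (freeF.map f)) (inclHom a A x) =
      inclHom a B (pi1.map ((iter loopF (a + 1)).map f) x) := by
  have h1 := congrArg (fun g => pi1.map g (pi1.map (incl.app ((iter loopF a).obj A)) x))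
    ((swapIter a).inv.naturality f)
  have h2 := congrArg (fun g => pi1.map ((swapIter a).inv.app B) (pi1.map g x))
    (incl.naturality ((iter loopF a).map f))
  have e1 := (pi1_map_comp_apply ((swapIter a).inv.app A) ((freeF ⋙ iter loopF a).map f)
    (pi1.map (incl.app ((iter loopF a).obj A)) x)).symm.trans (h1.symm.trans
      (pi1_map_comp_apply _ _ _))
  have e2 := (congrArg (pi1.map ((swapIter a).inv.app B)) (pi1_map_comp_apply
    (incl.app ((iter loopF a).obj A)) (freeF.map ((iter loopF a).map f)) x)).symm.trans
      (h2.symm.trans (congrArg (pi1.map ((swapIter a).inv.app B)) (pi1_map_comp_apply _ _ _)))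
  exact e1.trans e2

/-! ### The groups of `Ω^a L^m A` -/

/-- The fundamental group of `Ω^a L^m A`. -/
noncomputable abbrev loopFreeGroup (a m : ℕ) (A : PointedTop.{u}) : GrpCat.{u} :=
  pi1.obj ((iter loopF a).obj ((iter freeF m).obj A))

section

variable (a m : ℕ) (A : PointedTop.{u})

/-- Restriction to the first factor of the torus. -/
noncomputable def restrictHom : loopFreeGroup a (m + 1) A →* loopFreeGroup a m A := evHom a _

/-- Extension by constants from the first factors of the torus. -/
noncomputable def extendHom : loopFreeGroup a m A →* loopFreeGroup a (m + 1) A := constHom a _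

/-- The kernel of the restriction. -/
noncomputable def kernelHom : loopFreeGroup (a + 1) m A →* loopFreeGroup a (m + 1) A := inclHom a _

theorem kernelHom_injective : Function.Injective (kernelHom a m A) := inclHom_injective a _

theorem restrictHom_kernelHom (x) : restrictHom a m A (kernelHom a m A x) = 1 := evHom_inclHom a _ x

theorem exists_kernelHom_eq (x) (hx : restrictHom a m A x = 1) : ∃ y, kernelHom a m A y = x :=
  exists_inclHom_eq a _ x hx

theorem restrictHom_extendHom (x) : restrictHom a m A (extendHom a m A x) = x :=
  evHom_constHom a _ x

theorem loopFreeGroup_succ_of_left [Subsingleton (loopFreeGroup (a + 1) m A)] :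
    Nonempty (loopFreeGroup a (m + 1) A ≃* loopFreeGroup a m A) := by
  refine ⟨MulEquiv.ofBijective (restrictHom a m A) ⟨?_, fun x =>
    ⟨_, restrictHom_extendHom a m A x⟩⟩⟩
  rw [injective_iff_map_eq_one]
  intro x hx
  obtain ⟨y, rfl⟩ := exists_kernelHom_eq a m A x hx
  rw [Subsingleton.elim y 1, map_one]

theorem loopFreeGroup_succ_of_right [Subsingleton (loopFreeGroup a m A)] :
    Nonempty (loopFreeGroup a (m + 1) A ≃* loopFreeGroup (a + 1) m A) :=
  ⟨(MulEquiv.ofBijective (kernelHom a m A) ⟨kernelHom_injective a m A, fun x =>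
    exists_kernelHom_eq a m A x (Subsingleton.elim _ _)⟩).symm⟩

end

/-- `Equiv.sumArrowEquivProdArrow` as a multiplicative equivalence. -/
def sumArrowMulEquivProd (α β G : Type*) [Mul G] : (α ⊕ β → G) ≃* (α → G) × (β → G) where
  toEquiv := Equiv.sumArrowEquivProdArrow α β G
  map_mul' _ _ := rfl

/-- A split extension with commutative total group is a product. -/
theorem nonempty_mulEquiv_prod_of_split {K E Q : Type*} [Group K] [Group E] [Group Q] (f : K →* E)
    (g : E →* Q) (s : Q →* E) (hf : Function.Injective f) (hgf : ∀ x, g (f x) = 1)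
    (hg : ∀ x, g x = 1 → ∃ y, f y = x) (hs : ∀ x, g (s x) = x) (hE : ∀ x y : E, x * y = y * x) :
    Nonempty (E ≃* K × Q) := by
  let F : K × Q →* E := MonoidHom.noncommCoprod f s fun _ _ => hE _ _
  have hF (k q) : F (k, q) = f k * s q := rfl
  refine ⟨(MulEquiv.ofBijective F ⟨?_, fun x => ?_⟩).symm⟩
  · rw [injective_iff_map_eq_one]
    rintro ⟨k, q⟩ h
    rw [hF] at h
    have hq : q = 1 := by simpa [hgf, hs] using congrArg g h
    subst hq
    rw [map_one, mul_one] at h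
    rw [(injective_iff_map_eq_one f).1 hf k h]
    rfl
  · obtain ⟨k, hk⟩ := hg (x * (s (g x))⁻¹) (by simp [hs])
    exact ⟨(k, g x), by rw [hF, hk, inv_mul_cancel_right]⟩

/-- The source of Pascal's rule: the two factors become the two terms of the binomial recursion. -/
theorem loopFreeGroup_succ_of_commute (a m : ℕ) (A : PointedTop.{u})
    (h : ∀ x y : loopFreeGroup a (m + 1) A, x * y = y * x) :
    Nonempty (loopFreeGroup a (m + 1) A ≃* loopFreeGroup (a + 1) m A × loopFreeGroup a m A) :=
  nonempty_mulEquiv_prod_of_split (kernelHom a m A) (restrictHom a m A) (extendHom a m A)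
    (kernelHom_injective a m A) (restrictHom_kernelHom a m A) (exists_kernelHom_eq a m A)
    (restrictHom_extendHom a m A) h

/-! ### Faces of tori and commutativity -/

/-- The maps `L^(m+1) A ⟶ L^m A` that restrict an `(m+1)`-torus in `A` to a coordinate
`m`-torus. -/
inductive IsFace (A : PointedTop.{u}) :
    ∀ m : ℕ, ((iter freeF (m + 1)).obj A ⟶ (iter freeF m).obj A) → Prop
  | ev (m : ℕ) : IsFace A m (ev ((iter freeF m).obj A))
  | map (m : ℕ) (d : (iter freeF (m + 1)).obj A ⟶ (iter freeF m).obj A) :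
    IsFace A m d → IsFace A (m + 1) (freeF.map d)

/-- The homomorphism that is induced by a map `L^(m+1) A ⟶ L^m A`. -/
noncomputable def faceHom (a : ℕ) {m : ℕ}
    (d : (iter freeF (m + 1)).obj A ⟶ (iter freeF m).obj A) :
    loopFreeGroup a (m + 1) A →* loopFreeGroup a m A :=
  (pi1.map ((iter loopF a).map d)).hom

theorem faceHom_map_kernelHom (a m : ℕ) (d : (iter freeF (m + 1)).obj A ⟶ (iter freeF m).obj A)
    (x : loopFreeGroup (a + 1) (m + 1) A) :
    faceHom (m := m + 1) a (freeF.map d) (kernelHom a (m + 1) A x) =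
      kernelHom a m A (faceHom (a + 1) d x) :=
  inclHom_naturality a d x

/-- If all homotopy groups above degree `r + 1` vanish, then an element of the fundamental group of
`Ω^a L^(m+1) A`, where `a + m ≥ r`, is determined by its faces. -/
theorem eq_one_of_forall_isFace {r : ℕ} (hA : ∀ a, r < a → Subsingleton (loopFreeGroup a 0 A))
    (m : ℕ) : ∀ a, r ≤ a + m → ∀ x : loopFreeGroup a (m + 1) A,
      (∀ d, IsFace A m d → faceHom a d x = 1) → x = 1 := by
  induction m with
  | zero =>
    intro a ha x hx
    obtain ⟨y, rfl⟩ := exists_kernelHom_eq a 0 A x (hx _ (.ev 0))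
    have := hA (a + 1) (by omega)
    rw [Subsingleton.elim y 1, map_one]
  | succ m ih =>
    intro a ha x hx
    -- The evaluation face puts `x` in the kernel. The other faces `freeF.map d` of `x` are the
    -- images of the faces of `y`, so these vanish too, and `a + 1` makes up for the lost torus
    -- dimension.
    obtain ⟨y, rfl⟩ := exists_kernelHom_eq a (m + 1) A x (hx _ (.ev (m + 1)))
    have hy : y = 1 := ih (a + 1) (by omega) y fun d hd =>
      (injective_iff_map_eq_one _).1 (kernelHom_injective a m A) _
        ((faceHom_map_kernelHom a m d y).symm.trans (hx _ (.map m d hd)))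
    rw [hy, map_one]

theorem subsingleton_loopFreeGroup_of_lt {r : ℕ}
    (hA : ∀ a, a < r → Subsingleton (loopFreeGroup a 0 A)) (m : ℕ) :
    ∀ a, a + m < r → Subsingleton (loopFreeGroup a m A) := by
  induction m with
  | zero => exact fun a ha => hA a ha
  | succ m ih =>
    intro a ha
    have := ih a (by omega)
    have := ih (a + 1) (by omega)
    obtain ⟨e⟩ := loopFreeGroup_succ_of_left a m A
    exact e.toEquiv.subsingleton

theorem subsingleton_loopFreeGroup_of_gt {r : ℕ}
    (hA : ∀ a, r < a → Subsingleton (loopFreeGroup a 0 A)) (m : ℕ) :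
    ∀ a, r < a → Subsingleton (loopFreeGroup a m A) := by
  induction m with
  | zero => exact fun a ha => hA a ha
  | succ m ih =>
    intro a ha
    have := ih a ha
    have := ih (a + 1) (by omega)
    obtain ⟨e⟩ := loopFreeGroup_succ_of_left a m A
    exact e.toEquiv.subsingleton

/-- If `r ≤ a + m`, faces detect the identity, and each face of a commutator is a commutator in a
group that is commutative by induction. If `a + m < r`, the quotient of the extension is trivial and
the group is isomorphic to its kernel. -/
theorem loopFreeGroup_commute {r : ℕ} (hA : ∀ a, a ≠ r → Subsingleton (loopFreeGroup a 0 A))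
    (hr : ∀ x y : loopFreeGroup r 0 A, x * y = y * x) (m : ℕ) :
    ∀ a, ∀ x y : loopFreeGroup a m A, x * y = y * x := by
  induction m with
  | zero =>
    intro a
    by_cases ha : a = r
    · exact ha ▸ hr
    · have := hA a ha
      exact fun _ _ => Subsingleton.elim _ _
  | succ m ih =>
    intro a x y
    by_cases h : r ≤ a + m
    · rw [← commutatorElement_eq_one_iff_mul_comm]
      refine eq_one_of_forall_isFace (fun a ha => hA a ha.ne') m a h _ fun d _ => ?_
      rw [map_commutatorElement, commutatorElement_eq_one_iff_mul_comm]
      exact ih a _ _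
    · have := subsingleton_loopFreeGroup_of_lt (fun a ha => hA a ha.ne) m a (by omega)
      obtain ⟨e⟩ := loopFreeGroup_succ_of_right a m A
      apply e.injective
      rw [map_mul, map_mul]
      exact ih (a + 1) _ _

theorem nonempty_mulEquiv_choose {r : ℕ} {G : Type v} [CommGroup G]
    (hA : ∀ a, a ≠ r → Subsingleton (loopFreeGroup a 0 A))
    (e : loopFreeGroup r 0 A ≃* G) (m : ℕ) :
    ∀ k, k ≤ r → Nonempty (loopFreeGroup (r - k) m A ≃* (Fin (m.choose k) → G)) := by
  have hr : ∀ x y : loopFreeGroup r 0 A, x * y = y * x := fun x y =>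
    e.injective (by rw [map_mul, map_mul, mul_comm])
  induction m with
  | zero =>
    rintro (_ | k) hk
    · exact ⟨e.trans (MulEquiv.piUnique (fun _ : Fin 1 => G)).symm⟩
    · have := hA (r - (k + 1)) (by omega)
      have : Unique (loopFreeGroup (r - (k + 1)) 0 A) := uniqueOfSubsingleton 1
      rw [Nat.choose_zero_succ]
      exact ⟨MulEquiv.ofUnique⟩
  | succ m ih =>
    rintro (_ | k) hk
    · have := subsingleton_loopFreeGroup_of_gt (r := r) (fun a ha => hA a ha.ne') m (r + 1)
        (by omega)
      obtain ⟨f⟩ := loopFreeGroup_succ_of_left r m A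
      obtain ⟨g⟩ := ih 0 hk
      rw [Nat.choose_zero_right] at g ⊢
      exact ⟨f.trans g⟩
    · obtain ⟨f⟩ := loopFreeGroup_succ_of_commute (r - (k + 1)) m A
        (loopFreeGroup_commute hA hr (m + 1) _)
      obtain ⟨g⟩ := ih k (by omega)
      obtain ⟨h⟩ := ih (k + 1) hk
      rw [show r - (k + 1) + 1 = r - k by omega] at f
      -- `(m + 1).choose (k + 1)` unfolds to `m.choose k + m.choose (k + 1)`, the index set that
      -- `finSumFinEquiv` produces.
      exact ⟨f.trans ((g.prodCongr h).trans ((sumArrowMulEquivProd _ _ G).symm.trans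
        (MulEquiv.arrowCongr finSumFinEquiv (MulEquiv.refl G))))⟩

/-- Every kernel `π₁(Ω L^m A)` is trivial, so each restriction is an isomorphism and no
commutativity is needed. -/
theorem nonempty_mulEquiv_zero (hA : ∀ a, a ≠ 0 → Subsingleton (loopFreeGroup a 0 A)) (m : ℕ) :
    Nonempty (loopFreeGroup 0 m A ≃* loopFreeGroup 0 0 A) := by
  induction m with
  | zero => exact ⟨.refl _⟩
  | succ m ih =>
    have := subsingleton_loopFreeGroup_of_gt (r := 0) (fun a ha => hA a ha.ne') m 1 one_pos
    obtain ⟨e⟩ := loopFreeGroup_succ_of_left 0 m A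
    exact ih.map e.trans

/-! ### Tori and iterated free loops -/

/-- The projection of the unit interval onto the circle. -/
def circleMap : C(I, UnitAddCircle) := ⟨fun t => ((t : ℝ) : UnitAddCircle), by fun_prop⟩

theorem circleMap_surjective : Function.Surjective circleMap := fun x => by
  obtain ⟨t, ht, rfl⟩ := (AddCircle.coe_image_Icc_eq (1 : ℝ) 0).symm ▸ Set.mem_univ x
  exact ⟨⟨t, by simpa using ht⟩, rfl⟩

theorem eq_of_circleMap_eq {X : Type*} {f : I → X} (hf : f 0 = f 1) {s t : I}
    (h : circleMap s = circleMap t) : f s = f t := by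
  have h' : ((s - t : ℝ) : UnitAddCircle) = 0 := by
    rw [AddCircle.coe_sub, sub_eq_zero]
    exact h
  obtain ⟨n, hn⟩ := (AddCircle.coe_eq_zero_iff (1 : ℝ)).1 h'
  rw [zsmul_eq_mul, mul_one] at hn
  have s0 := s.2.1
  have s1 := s.2.2
  have t0 := t.2.1
  have t1 := t.2.2
  have h1 : -1 ≤ n := by exact_mod_cast (by linarith : (-1 : ℝ) ≤ n)
  have h2 : n ≤ 1 := by exact_mod_cast (by linarith : (n : ℝ) ≤ 1)
  obtain rfl | rfl | rfl : n = -1 ∨ n = 0 ∨ n = 1 := by omega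
  · obtain rfl : s = 0 := Subtype.ext (by push_cast at hn ⊢; linarith)
    obtain rfl : t = 1 := Subtype.ext (by push_cast at hn ⊢; linarith)
    exact hf
  · obtain rfl : s = t := Subtype.ext (by push_cast at hn ⊢; linarith)
    rfl
  · obtain rfl : s = 1 := Subtype.ext (by push_cast at hn ⊢; linarith)
    obtain rfl : t = 0 := Subtype.ext (by push_cast at hn ⊢; linarith)
    exact hf.symm

/-- Products with an identity need not preserve quotient maps. Here `circleMap` is proper, as `I` is
compact and the circle Hausdorff, so the product is closed for every `Y`, in particular for a free
loop space. -/
theorem isQuotientMap_id_prod_circleMap (Y : Type*) [TopologicalSpace Y] :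
    Topology.IsQuotientMap (Prod.map (id : Y → Y) circleMap) := by
  have hp : IsProperMap circleMap := circleMap.continuous.isProperMap
  exact (isProperMap_id.prodMap hp).isClosedMap.isQuotientMap
    (continuous_id.prodMap circleMap.continuous)
    (Function.surjective_id.prodMap circleMap_surjective)

/-- The function on the circle that is induced by a free loop. -/
noncomputable def circleLift (γ : freeObj A) (x : UnitAddCircle) : A :=
  γ.1 (Function.surjInv circleMap_surjective x)

theorem circleLift_circleMap (γ : freeObj A) (t : I) : circleLift γ (circleMap t) = γ.1 t :=
  eq_of_circleMap_eq γ.2 (Function.surjInv_eq circleMap_surjective _)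

theorem continuous_uncurry_circleLift :
    Continuous fun z : freeObj A × UnitAddCircle => circleLift z.1 z.2 := by
  rw [(isQuotientMap_id_prod_circleMap (freeObj A)).continuous_iff]
  have : (fun z : freeObj A × UnitAddCircle => circleLift z.1 z.2) ∘ Prod.map id circleMap =
      fun z : freeObj A × I => z.1.1 z.2 := funext fun z => circleLift_circleMap z.1 z.2
  rw [this]
  fun_prop

/-- The space of maps from `K` to `A`, based at the constant map. -/
abbrev mapObj (K : Type) [TopologicalSpace K] (A : PointedTop.{u}) : PointedTop.{u} :=
  ⟨C(K, A), .const K A.pt⟩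

/-- Maps from the circle are free loops. -/
noncomputable def circleIso (A : PointedTop.{u}) : mapObj UnitAddCircle A ≅ freeObj A :=
  isoOfHomeomorph
    { toFun := fun f => ⟨f.comp circleMap, congrArg f (by
        change ((0 : ℝ) : UnitAddCircle) = ((1 : ℝ) : UnitAddCircle)
        rw [AddCircle.coe_period]; rfl)⟩
      invFun := fun γ => ⟨circleLift γ, continuous_uncurry_circleLift.comp
        (Continuous.prodMk_right γ)⟩
      left_inv := fun f => ContinuousMap.ext fun x =>
        congrArg f (Function.surjInv_eq circleMap_surjective x)
      right_inv := fun γ => Subtype.ext (ContinuousMap.ext (circleLift_circleMap γ))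
      continuous_toFun := continuous_into_freeObj (by dsimp; fun_prop)
      continuous_invFun :=
        ContinuousMap.continuous_of_continuous_uncurry _ continuous_uncurry_circleLift }
    rfl

/-- Splitting off the first coordinate of a torus. -/
def torusSucc (m : ℕ) :
    UnitAddTorus (Fin (m + 1)) ≃ₜ UnitAddCircle × UnitAddTorus (Fin m) where
  toEquiv := (Fin.consEquiv fun _ => UnitAddCircle).symm
  continuous_toFun := by
    change Continuous fun f : UnitAddTorus (Fin (m + 1)) =>
      (f 0, fun i : Fin m => f i.succ)
    exact (continuous_apply 0).prodMk (continuous_pi fun i : Fin m => continuous_apply i.succ)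
  continuous_invFun := by
    change Continuous fun f : UnitAddCircle × UnitAddTorus (Fin m) =>
      (Fin.cons f.1 f.2 : UnitAddTorus (Fin (m + 1)))
    refine continuous_pi (Fin.cases ?_ fun i => ?_)
    · exact continuous_fst
    · exact (continuous_apply i).comp continuous_snd

/-- Maps from the `m`-torus are `m`-fold iterated free loops. -/
theorem nonempty_torus_iso (A : PointedTop.{u}) :
    ∀ m : ℕ, Nonempty (mapObj (UnitAddTorus (Fin m)) A ≅ (iter freeF m).obj A)
  | 0 => ⟨(isoOfHomeomorph (Homeomorph.continuousMapOfUnique (X := UnitAddTorus (Fin 0)))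
      rfl : A ≅ _).symm⟩
  | m + 1 => by
    obtain ⟨e⟩ := nonempty_torus_iso A m
    have e1 : mapObj (UnitAddTorus (Fin (m + 1))) A ≅
        mapObj UnitAddCircle (mapObj (UnitAddTorus (Fin m)) A) :=
      isoOfHomeomorph (((torusSucc m).arrowCongr (.refl A)).trans Homeomorph.curry) rfl
    exact ⟨e1 ≪≫ circleIso _ ≪≫ freeF.mapIso e⟩

/-! ### Homotopy groups and iterated based loops -/

/-- The space of generalized loops, based at the constant one. -/
abbrev genLoopObj (N : Type) (A : PointedTop.{u}) : PointedTop.{u} :=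
  ⟨GenLoop N A A.pt, GenLoop.const⟩

/-- Generalized loops are iterated based loops. -/
theorem nonempty_genLoop_iso (A : PointedTop.{u}) (k : ℕ) :
    ∀ (N : Type) [Fintype N] [DecidableEq N], Fintype.card N = k →
      Nonempty (genLoopObj N A ≅ (iter loopF k).obj A) := by
  induction k with
  | zero =>
    intro N _ _ h
    have := Fintype.card_eq_zero_iff.1 h
    exact ⟨(isoOfHomeomorph (genLoopHomeoOfIsEmpty N A.pt) rfl : _ ≅ A)⟩
  | succ k ih =>
    intro N _ _ h
    obtain ⟨i⟩ := Fintype.card_pos_iff.1 (h.trans_gt k.succ_pos)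
    obtain ⟨e⟩ := ih {j // j ≠ i} (by simp [Fintype.card_subtype_compl, h])
    have e1 : genLoopObj N A ≅ loopObj (genLoopObj {j // j ≠ i} A) :=
      isoOfHomeomorph (GenLoop.loopHomeo i) rfl
    exact ⟨e1 ≪≫ loopF.mapIso e⟩

/-- Higher homotopy groups are fundamental groups of iterated loop spaces. -/
theorem nonempty_homotopyGroup_mulEquiv (A : PointedTop.{u}) (n : ℕ) [NeZero n] :
    Nonempty (π_ n A A.pt ≃* loopFreeGroup (n - 1) 0 A) := by
  let i : Fin n := Classical.arbitrary (Fin n)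
  obtain ⟨e⟩ := nonempty_genLoop_iso A (n - 1) {j // j ≠ i} (by simp [Fintype.card_subtype_compl])
  let e1 : π_ n A A.pt ≃* pi1.obj (genLoopObj {j // j ≠ i} A) :=
    (homotopyGroupEquivFundamentalGroup i).mulEquiv
  exact ⟨e1.trans (pi1.mapIso e).groupIsoToMulEquiv⟩

theorem nonempty_foxTorusGroup_mulEquiv (m : ℕ) (X : Type u) [TopologicalSpace X] (x₀ : X) :
    Nonempty (FoxTorusGroup m X x₀ ≃* loopFreeGroup 0 (m - 1) ⟨X, x₀⟩) := by
  obtain ⟨e⟩ := nonempty_torus_iso ⟨X, x₀⟩ (m - 1)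
  exact ⟨(pi1.mapIso e).groupIsoToMulEquiv⟩

end PointedTop

/-! ### Eilenberg–MacLane spaces -/

section

variable {X : Type u} [TopologicalSpace X]

open PointedTop

/-- `π₁(Ω^a X)` is `π_(a+1)(X)`, so the exceptional degree `n` becomes `a = n - 1`. -/
theorem IsEilenbergMacLane.subsingleton_loopFreeGroup {G : Type v} [Group G] {n : ℕ} [NeZero n]
    (h : IsEilenbergMacLane G n X) (x₀ : X) (a : ℕ) (ha : a ≠ n - 1) :
    Subsingleton (loopFreeGroup a 0 ⟨X, x₀⟩) := by
  have hn := NeZero.ne n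
  obtain ⟨e⟩ := nonempty_homotopyGroup_mulEquiv ⟨X, x₀⟩ (a + 1)
  have := h.subsingleton_of_ne (a + 1) (by omega) x₀
  exact e.symm.toEquiv.subsingleton

theorem IsEilenbergMacLane.nonempty_loopFreeGroup_mulEquiv {G : Type v} [Group G] {n : ℕ}
    [NeZero n] (h : IsEilenbergMacLane G n X) (x₀ : X) :
    Nonempty (loopFreeGroup (n - 1) 0 ⟨X, x₀⟩ ≃* G) := by
  obtain ⟨e⟩ := nonempty_homotopyGroup_mulEquiv ⟨X, x₀⟩ n
  obtain ⟨f⟩ := h.nonempty_mulEquiv x₀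
  exact ⟨e.symm.trans f⟩

theorem IsEilenbergMacLane.nonempty_foxTorusGroup_mulEquiv {G : Type v} [CommGroup G] {n : ℕ}
    [NeZero n] (h : IsEilenbergMacLane G n X) (x₀ : X) (m : ℕ) :
    Nonempty (FoxTorusGroup m X x₀ ≃* (Fin ((m - 1).choose (n - 1)) → G)) := by
  obtain ⟨e⟩ := PointedTop.nonempty_foxTorusGroup_mulEquiv m X x₀
  obtain ⟨f⟩ := h.nonempty_loopFreeGroup_mulEquiv x₀
  -- Taking `k = r = n - 1` leaves no based loops, only the torus directions.
  obtain ⟨g⟩ := nonempty_mulEquiv_choose (h.subsingleton_loopFreeGroup x₀) f (m - 1) (n - 1) le_rfl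
  rw [Nat.sub_self] at g
  exact ⟨e.trans g⟩

end

/-- The hockey-stick identity: once the right side is reflected, the induction step is Pascal's
rule. -/
theorem Nat.sum_range_choose_sub_two (n k : ℕ) (hn : 2 ≤ n) :
    ∑ j ∈ Finset.range (k + 1), (n - 2 + j).choose (n - 2) = (n + k - 1).choose k := by
  obtain ⟨n, rfl⟩ := Nat.exists_eq_add_of_le hn
  have h : ∀ j, (2 + n - 2 + j).choose (2 + n - 2) = (n + j).choose n := fun j => by
    rw [Nat.add_sub_cancel_left]
  simp only [h]
  rw [show 2 + n + k - 1 = (n + 1) + k by omega, ← Nat.choose_symm_add]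
  induction k with
  | zero => simp
  | succ k ih =>
    rw [Finset.sum_range_succ, ih, ← add_assoc (n + 1) k 1, Nat.choose_succ_succ, add_comm,
      show n + (k + 1) = n + 1 + k by omega]

theorem mainTheorem11 {X : Type u} [TopologicalSpace X] (x₀ : X) :
    -- the case `n ≥ 2`, for an abelian group `G`
    (∀ (n : ℕ) [NeZero n] (G : Type v) [CommGroup G], 2 ≤ n → IsEilenbergMacLane G n X →
      -- `τ_m(X) ≅ π_m(X)` for `1 ≤ m ≤ n`
      (∀ (m : ℕ) [NeZero m], m ≤ n → Nonempty (FoxTorusGroup m X x₀ ≃* π_ m X x₀)) ∧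
      -- `τ_m(X)` is trivial for `1 ≤ m < n`
      (∀ m : ℕ, 1 ≤ m → m < n → Subsingleton (FoxTorusGroup m X x₀)) ∧
      -- `τ_{n+k}(X)` is the direct sum of the `π_n(X)^{C(n-2+j, n-2)}`, `0 ≤ j ≤ k`
      (∀ k : ℕ, Nonempty (FoxTorusGroup (n + k) X x₀ ≃*
        ((j : Fin (k + 1)) → Fin ((n - 2 + (j : ℕ)).choose (n - 2)) → π_ n X x₀))) ∧
      -- the number of summands is `C(n+k-1, k)`
      (∀ k : ℕ, ∑ j ∈ Finset.range (k + 1), (n - 2 + j).choose (n - 2) =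
        (n + k - 1).choose k) ∧
      -- `τ_m(X) ≅ G^{C(m-1, m-n)}` for `m ≥ n`
      (∀ m : ℕ, n ≤ m →
        Nonempty (FoxTorusGroup m X x₀ ≃* (Fin ((m - 1).choose (m - n)) → G)))) ∧
    -- the case `n = 1`, for an arbitrary group `G`
    (∀ (G : Type v) [Group G], IsEilenbergMacLane G 1 X →
      ∀ k : ℕ, 1 ≤ k → Nonempty (FoxTorusGroup k X x₀ ≃* G)) := by
  refine ⟨fun n _ G _ hn h => ?_, fun G _ h k hk => ?_⟩
  · have hlt (m : ℕ) (h1 : 1 ≤ m) (hm : m < n) : Subsingleton (FoxTorusGroup m X x₀) := by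
      obtain ⟨e⟩ := h.nonempty_foxTorusGroup_mulEquiv x₀ m
      rw [Nat.choose_eq_zero_of_lt (by omega)] at e
      exact e.toEquiv.subsingleton
    have hge (m : ℕ) (hm : n ≤ m) :
        Nonempty (FoxTorusGroup m X x₀ ≃* (Fin ((m - 1).choose (m - n)) → G)) := by
      rw [← Nat.choose_symm (by omega), show m - 1 - (m - n) = n - 1 by omega]
      exact h.nonempty_foxTorusGroup_mulEquiv x₀ m
    obtain ⟨f⟩ := h.nonempty_mulEquiv x₀
    refine ⟨fun m _ hm => ?_, hlt, fun k => ?_, fun k => Nat.sum_range_choose_sub_two n k hn, hge⟩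
    · have hm0 := NeZero.ne m
      rcases hm.eq_or_lt with rfl | hm
      · obtain ⟨e⟩ := hge m le_rfl
        rw [Nat.sub_self, Nat.choose_zero_right] at e
        exact ⟨(e.trans (MulEquiv.piUnique fun _ : Fin 1 => G)).trans f.symm⟩
      · have := hlt m (by omega) hm
        have := h.subsingleton_of_ne m hm.ne x₀
        have : Unique (FoxTorusGroup m X x₀) := uniqueOfSubsingleton 1
        have : Unique (π_ m X x₀) := uniqueOfSubsingleton 1
        exact ⟨MulEquiv.ofUnique⟩
    · obtain ⟨e⟩ := hge (n + k) (Nat.le_add_right n k)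
      rw [Nat.add_sub_cancel_left, ← Nat.sum_range_choose_sub_two n k hn, Finset.sum_range] at e
      -- The exponent, written as a sum, indexes a disjoint union of blocks; currying over the
      -- blocks gives the iterated product.
      refine ⟨e.trans ((MulEquiv.arrowCongr finSigmaFinEquiv.symm f.symm).trans ?_)⟩
      exact { Equiv.piCurry fun (j : Fin (k + 1))
          (_ : Fin ((n - 2 + (j : ℕ)).choose (n - 2))) => π_ n X x₀ with
        map_mul' := fun _ _ => rfl }
  · obtain ⟨e⟩ := PointedTop.nonempty_foxTorusGroup_mulEquiv k X x₀
    obtain ⟨f⟩ := PointedTop.nonempty_mulEquiv_zero (h.subsingleton_loopFreeGroup x₀) (k - 1)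
    obtain ⟨g⟩ := h.nonempty_loopFreeGroup_mulEquiv x₀
    exact ⟨e.trans (f.trans g)⟩
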